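/- Let $n$ be a positive integer, let $q\in\mathbb C$ with $q\neq 0$ and $q^2\neq 1$, and for $z\in\mathbb C$ let $q^{z}=\exp(z\operatorname{Log} q)$ ($\operatorname{Log}$ the principal logarithm) and $[z]=\dfrac{q^{z}-q^{-z}}{q-q^{-1}}$. **Square ice.** Orient every edge of the $n\times n$ square grid (including the $4n$ boundary edges), with rows numbered from top to bottom and columns from left to right. The orientation is a square ice configuration if at every vertex two arrows point in and two point out, all left and right boundary edges point inward, and all top and bottom boundary edges point outward; let $\mathbb S_n$ be the set of these configurations. Given arbitrary complex parameters $X=(x_1,\dots,x_n)$ and $Y=(y_1,\dots,y_n)$ (not necessarily distinct), put $\xi=x_i-y_j$ and give the vertex $v$ in row $i$ and column $j$ the weight $w(v)$ equal to * $-q^{-\xi}$ if both horizontal arrows point in and both vertical arrows point out; * $-q^{\xi}$ if both horizontal arrows point out and both vertical arrows point in; * $[\xi-1]$ if the horizontal arrows point right and the vertical arrows up, or the horizontal arrows point left and the vertical arrows down; * $[\xi]$ if the horizontal arrows point left and the vertical arrows up, or the horizontal arrows point right and the vertical arrows down. The partition function is $Z_n(X,Y)=\sum_{G\in\mathbb S_n}\prod_{v\in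 G}w(v)$. **Theorem.** Let $u_i=q^{2x_i}$, $v_i=q^{2y_i}$ for $1\le i\le n$, $U=(u_1,\dots,u_n)$, $V=(v_1,\dots,v_n)$. Then $$Z_n(X,Y)=\frac{(-1)^{n^2}}{(q^2-1)^{n^2-n}\prod_{i=1}^{n}(v_iu_i)^{n/2}\,v_i^{-1}}\; F_{q^2}(V,U),$$ where $(v_iu_i)^{n/2}$ means $q^{n(x_i+y_i)}$, and $F_{q^2}(V,U)$ is the determinant of the product of matrices $$\bigl(h_{j-i}(V)\bigr)_{1\le i\le n,\;1\le j\le 2n-1}\times\left(\frac{q^{2j-2k+2}-q^{2k-2}}{q^2-1}\,(-1)^{n-j+k-1}\,e_{n-j+k-1}(U)\right)_{1\le j\le 2n-1,\;1\le k\le n}.$$ Here $h_m$ and $e_m$ are the complete homogeneous and the elementary symmetric functions in $n$ variables, with $h_m=e_m=0$ for $m<0$. -/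

import Mathlib

open scoped BigOperators

namespace SquareIce

noncomputable section

/-- An orientation of all edges of the `n × n` square grid, including the `4 n` boundary edges.
Rows are numbered from top to bottom and columns from left to right.
* `horiz i j` is the horizontal edge of row `i` to the left of column `j` (for `j = n`: the right
  boundary edge); `true` means that its arrow points right, `false` that it points left.
* `vert i j` is the vertical edge of column `j` above row `i` (for `i = n`: the bottom boundary
  edge); `true` means that its arrow points up, `false` that it points down. -/
abbrev Arrows (n : ℕ) : Type :=
  (Fin n → Fin (n + 1) → Bool) × (Fin (n + 1) → Fin n → Bool)

/-- The arrow on the horizontal edge of row `i` left of column `j`: does it point right? -/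
abbrev Arrows.horiz {n : ℕ} (G : Arrows n) (i : Fin n) (j : Fin (n + 1)) : Bool := G.1 i j

/-- The arrow on the vertical edge of column `j` above row `i`: does it point up? -/
abbrev Arrows.vert {n : ℕ} (G : Arrows n) (i : Fin (n + 1)) (j : Fin n) : Bool := G.2 i j

/-- Zero divergence at a vertex whose left, right, bottom and top edges carry the arrows
`l r` (`true` = right) and `b t` (`true` = up): exactly two of the four arrows point in. -/
def ZeroDivergence (l r b t : Bool) : Prop :=
  l.toNat + (!r).toNat + b.toNat + (!t).toNat = 2

/-- The six vertex states. -/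
inductive VertexState : Type
  | one
  | two
  | three
  | four
  | five
  | six

/-- The state of a vertex with given left, right, bottom and top arrows
(horizontally `true` = right, vertically `true` = up); `none` if the arrows violate zero
divergence. -/
def vertexState : (l r b t : Bool) → Option VertexState
  -- horizontal arrows in, vertical arrows out
  | true, false, false, true => some .one
  -- horizontal arrows out, vertical arrows in
  | false, true, true, false => some .two
  -- right and up
  | true, true, true, true => some .three
  -- left and down
  | false, false, false, false => some .four
  -- left and up
  | false, false, true, true => some .five
  -- right and down
  | true, true, false, false => some .six
  | _, _, _, _ => none

/-- The arrows that have a vertex state are exactly those of zero divergence. -/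
theorem vertexState_isSome_iff (l r b t : Bool) :
    (vertexState l r b t).isSome = true ↔ ZeroDivergence l r b t := by
  cases l <;> cases r <;> cases b <;> cases t <;> simp [vertexState, ZeroDivergence]

/-- Square ice: zero divergence at every vertex, left and right boundary edges point inward,
top and bottom boundary edges point outward. -/
def IsSquareIce {n : ℕ} (G : Arrows n) : Prop :=
  (∀ i j : Fin n,
    ZeroDivergence (G.horiz i j.castSucc) (G.horiz i j.succ)
      (G.vert i.succ j) (G.vert i.castSucc j)) ∧
  (∀ i : Fin n, G.horiz i 0 = true) ∧
  (∀ i : Fin n, G.horiz i (Fin.last n) = false) ∧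
  (∀ j : Fin n, G.vert 0 j = true) ∧
  (∀ j : Fin n, G.vert (Fin.last n) j = false)

open Classical in
/-- The finite set of all `n × n` square ice configurations. -/
def configurations (n : ℕ) : Finset (Arrows n) :=
  Finset.univ.filter fun G => IsSquareIce G

/-- `[ξ] = (q ^ ξ - q ^ (-ξ)) / (q - q⁻¹)`. -/
def bracket (q ξ : ℂ) : ℂ :=
  (q ^ ξ - q ^ (-ξ)) / (q - q⁻¹)

/-- The weight of a vertex state, where `ξ` is the difference of the row parameter and the
column parameter of the vertex. -/
def stateWeight (q ξ : ℂ) : VertexState → ℂ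
  | .one => -q ^ (-ξ)
  | .two => -q ^ ξ
  | .three => bracket q (ξ - 1)
  | .four => bracket q (ξ - 1)
  | .five => bracket q ξ
  | .six => bracket q ξ

/-- The weight of the vertex `(i, j)` in `G`, for row parameters `x` and column parameters `y`.
(The value `0` is never taken through `none` when `G` is square ice.) -/
def vertexWeight (q : ℂ) {n : ℕ} (x y : Fin n → ℂ) (G : Arrows n) (i j : Fin n) : ℂ :=
  match vertexState (G.horiz i j.castSucc) (G.horiz i j.succ)
      (G.vert i.succ j) (G.vert i.castSucc j) with
  | some s => stateWeight q (x i - y j) s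
  | none => 0

/-- The weight of a configuration: the product of the weights of its vertices. -/
def weight (q : ℂ) {n : ℕ} (x y : Fin n → ℂ) (G : Arrows n) : ℂ :=
  ∏ i : Fin n, ∏ j : Fin n, vertexWeight q x y G i j

/-- The partition function `Z_n(X, Y)` of square ice. -/
def partitionFunction (q : ℂ) {n : ℕ} (x y : Fin n → ℂ) : ℂ :=
  ∑ G ∈ configurations n, weight q x y G

/-- The elementary symmetric function `e_k(u_1, …, u_n)`, with `e_k = 0` for `k < 0`. -/
def elemSymm {n : ℕ} (u : Fin n → ℂ) (k : ℤ) : ℂ :=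
  if k < 0 then 0 else MvPolynomial.eval u (MvPolynomial.esymm (Fin n) ℂ k.toNat)

/-- The complete homogeneous symmetric function `h_k(v_1, …, v_n)`, with `h_k = 0` for
`k < 0`. -/
def complSymm {n : ℕ} (v : Fin n → ℂ) (k : ℤ) : ℂ :=
  if k < 0 then 0 else MvPolynomial.eval v (MvPolynomial.hsymm (Fin n) ℂ k.toNat)

/-- The `n × (2 n - 1)` matrix `(h_{j - i}(V))`, where `i, j` are counted from `1`. -/
def hMatrix {n : ℕ} (v : Fin n → ℂ) : Matrix (Fin n) (Fin (2 * n - 1)) ℂ :=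
  Matrix.of fun a b =>
    let i : ℤ := (a : ℕ) + 1
    let j : ℤ := (b : ℕ) + 1
    complSymm v (j - i)

/-- The `(2 n - 1) × n` matrix with entries
`(t ^ (j - k + 1) - t ^ (k - 1)) / (t - 1) * (-1) ^ (n - j + k - 1) * e_{n - j + k - 1}(U)`,
where `j, k` are counted from `1`; the exponents and the index are integers. -/
def eMatrix (t : ℂ) {n : ℕ} (u : Fin n → ℂ) : Matrix (Fin (2 * n - 1)) (Fin n) ℂ :=
  Matrix.of fun b c =>
    let j : ℤ := (b : ℕ) + 1
    let k : ℤ := (c : ℕ) + 1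
    (t ^ (j - k + 1) - t ^ (k - 1)) / (t - 1)
      * (-1) ^ ((n : ℤ) - j + k - 1) * elemSymm u ((n : ℤ) - j + k - 1)

/-- `F_t(V, U)`: the determinant of the product of the two rectangular matrices. -/
def lascouxDet (t : ℂ) {n : ℕ} (v u : Fin n → ℂ) : ℂ :=
  (hMatrix v * eMatrix t u).det

end

end SquareIce

namespace SquareIce

noncomputable section

/-! In the variables `u = q ^ (2 * x)`, `v = q ^ (2 * y)`, after a monomial prefactor is removed,
the vertex weights become polynomials in `u` and `v`, and the partition function becomes the
polynomial `icePolynomial`, an entry of a product of row transfer matrices. The Yang–Baxter equation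
makes the transfer matrices commute, so this polynomial is symmetric in `u`
(`icePolynomial_comp_perm`).

On the other side, the `h`-matrix times the Vandermonde determinant of `v` can be traded for a
matrix of powers of the `v j` (`det_powerMatrix_mul`). The entries of the resulting product have a
closed form in terms of `∏ (t * v - u i)` and `∏ (v - u i)`.

With size `n + 1`, both sides multiplied by the Vandermonde determinant are polynomials of degree at
most `2 * n + 1` in the first column parameter `z`. They are compared at `2 * n + 2` points. At `z =
0` both vanish; at the other column parameters the Vandermonde determinant vanishes on one side and
two rows coincide on the other; at `z = u i` a corner vertex freezes (`icePolynomial_cons_last`),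
the determinant satisfies the same recursion (`det_powerMatrix_mul_eMatrix_cons_last`), and
induction applies. Continuity then removes the assumption that the parameters are distinct and
nonzero. -/

/-! ### Transfer matrices. -/

theorem listProd_apply_eq_sum_paths {R S : Type*} [CommRing R] [Fintype S] [DecidableEq S] :
    ∀ (n : ℕ) (A : Fin n → Matrix S S R) (a b : S),
      (List.ofFn A).prod a b =
        ∑ p : Fin (n + 1) → S,
          if p 0 = a ∧ p (Fin.last n) = b then ∏ i : Fin n, A i (p i.castSucc) (p i.succ) else 0
  | 0, A, a, b => by
    rw [← (Equiv.funUnique (Fin 1) S).symm.sum_comp]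
    by_cases h : a = b
    · subst h
      rw [Finset.sum_eq_single a]
      · simp
      · intro c _ hc
        simp [hc]
      · simp
    · rw [Finset.sum_eq_zero]
      · simp [h]
      · intro c _
        rw [if_neg]
        rintro ⟨h1, h2⟩
        exact h (h1.symm.trans h2)
  | n + 1, A, a, b => by
    rw [List.ofFn_succ, List.prod_cons, Matrix.mul_apply,
      ← (Fin.consEquiv fun _ : Fin (n + 2) => S).sum_comp, Fintype.sum_prod_type]
    symm
    rw [Finset.sum_eq_single a]
    · simp_rw [listProd_apply_eq_sum_paths n, Finset.mul_sum]
      rw [Finset.sum_comm]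
      refine Finset.sum_congr rfl fun p _ => ?_
      rw [Finset.sum_eq_single (p 0)]
      · simp [Fin.consEquiv, Fin.prod_univ_succ, ← Fin.succ_last]
      · intro c _ hc
        rw [if_neg fun h => hc h.1.symm, mul_zero]
      · simp
    · intro c _ hc
      simp [Fin.consEquiv, hc]
    · simp

/-- The six-vertex weights in the variables `u = q ^ (2 x)`, `v = q ^ (2 y)`, cleared of the
common factor `q ^ (-ξ) / (v (q ^ 2 - 1))`. -/
def iceWeight (q u v : ℂ) (l r b t : Bool) : ℂ :=
  match vertexState l r b t with
  | some .one => (1 - q ^ 2) * v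
  | some .two => (1 - q ^ 2) * u
  | some .three => u - q ^ 2 * v
  | some .four => u - q ^ 2 * v
  | some .five => q * (u - v)
  | some .six => q * (u - v)
  | none => 0

/-- The vertex weights with fixed vertical arrows, as a matrix in the horizontal arrows. -/
def vertexMatrix (q u v : ℂ) (t b : Bool) : Matrix Bool Bool ℂ :=
  Matrix.of fun l r => iceWeight q u v l r b t

/-- The row-to-row transfer matrix with horizontal boundary arrows pointing inward. -/
def rowMatrix (q : ℂ) {n : ℕ} (u : ℂ) (v : Fin n → ℂ) : Matrix (Fin n → Bool) (Fin n → Bool) ℂ :=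
  Matrix.of fun top bot =>
    (List.ofFn fun j => vertexMatrix q u (v j) (top j) (bot j)).prod true false

/-- The partition function in the variables `u`, `v`, as an entry of a product of row-to-row
transfer matrices. -/
def icePolynomial (q : ℂ) {m n : ℕ} (u : Fin m → ℂ) (v : Fin n → ℂ) (top bot : Fin n → Bool) : ℂ :=
  (List.ofFn fun i => rowMatrix q (u i) v).prod top bot

/-! ### Yang–Baxter equation and symmetry in the row parameters. -/

open Kronecker in
/-- Two vertically adjacent vertices with fixed outer vertical arrows. -/
def doubleVertexMatrix (q u w v : ℂ) (t b : Bool) : Matrix (Bool × Bool) (Bool × Bool) ℂ :=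
  ∑ m : Bool, vertexMatrix q u v t m ⊗ₖ vertexMatrix q w v m b

/-- The matrix intertwining two rows. -/
def intertwiner (q u w : ℂ) : Matrix (Bool × Bool) (Bool × Bool) ℂ :=
  Matrix.of fun a b =>
    match a, b with
    | (true, true), (true, true) => w - q ^ 2 * u
    | (false, false), (false, false) => w - q ^ 2 * u
    | (true, false), (true, false) => (1 - q ^ 2) * u
    | (false, true), (false, true) => (1 - q ^ 2) * w
    | (true, false), (false, true) => q * (w - u)
    | (false, true), (true, false) => q * (w - u)
    | _, _ => 0

/-- The Yang–Baxter equation at a single column, a finite list of polynomial identities. -/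
theorem intertwiner_mul_doubleVertexMatrix (q u w v : ℂ) (t b : Bool) :
    intertwiner q u w * doubleVertexMatrix q u w v t b =
      doubleVertexMatrix q w u v t b * intertwiner q u w := by
  ext ⟨a, a'⟩ ⟨c, c'⟩
  simp only [Matrix.mul_apply, Fintype.sum_prod_type, Fintype.sum_bool, doubleVertexMatrix,
    Matrix.add_apply, Matrix.kronecker_apply, vertexMatrix, intertwiner, Matrix.of_apply]
  cases t <;> cases b <;> cases a <;> cases a' <;> cases c <;> cases c' <;>
    simp only [iceWeight, vertexState] <;> ring

/-- The intertwiner is pushed through the two rows one column at a time, exchanging `u` and `w`. -/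
theorem intertwiner_mul_listProd (q u w : ℂ) : ∀ (n : ℕ) (v : Fin n → ℂ) (t b : Fin n → Bool),
    intertwiner q u w * (List.ofFn fun j => doubleVertexMatrix q u w (v j) (t j) (b j)).prod =
      (List.ofFn fun j => doubleVertexMatrix q w u (v j) (t j) (b j)).prod * intertwiner q u w
  | 0, _, _, _ => by simp
  | n + 1, v, t, b => by
    rw [List.ofFn_succ, List.ofFn_succ, List.prod_cons, List.prod_cons, ← mul_assoc,
      intertwiner_mul_doubleVertexMatrix, mul_assoc, intertwiner_mul_listProd, mul_assoc]

-- By the mixed-product property of the Kronecker product, the sum over the arrows between two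
-- adjacent rows can be carried out column by column.
open Kronecker in
theorem sum_kronecker_listProd {R S T : Type*} [CommRing R] [Fintype S] [DecidableEq S]
    [Fintype T] : ∀ (n : ℕ) (A B : Fin n → T → Matrix S S R),
    ∑ m : Fin n → T, (List.ofFn fun j => A j (m j)).prod ⊗ₖ (List.ofFn fun j => B j (m j)).prod =
      (List.ofFn fun j => ∑ m : T, A j m ⊗ₖ B j m).prod
  | 0, _, _ => by simp
  | n + 1, A, B => by
    rw [← (Fin.consEquiv fun _ : Fin (n + 1) => T).sum_comp, Fintype.sum_prod_type,
      List.ofFn_succ, List.prod_cons, ← sum_kronecker_listProd n, Finset.sum_mul]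
    refine Finset.sum_congr rfl fun m _ => ?_
    rw [Finset.mul_sum]
    refine Finset.sum_congr rfl fun p _ => ?_
    simp [Fin.consEquiv, List.ofFn_succ, Matrix.mul_kronecker_mul]

theorem rowMatrix_mul_apply (q u w : ℂ) {n : ℕ} (v : Fin n → ℂ) (t b : Fin n → Bool) :
    (rowMatrix q u v * rowMatrix q w v) t b =
      (List.ofFn fun j => doubleVertexMatrix q u w (v j) (t j) (b j)).prod
        (true, true) (false, false) := by
  simp only [doubleVertexMatrix]
  rw [← sum_kronecker_listProd n (fun j m => vertexMatrix q u (v j) (t j) m)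
    (fun j m => vertexMatrix q w (v j) m (b j)), Matrix.mul_apply, Matrix.sum_apply]
  rfl

/-- At the boundary states `(true, true)` and `(false, false)` the intertwiner is diagonal with the
same entry `w - q ^ 2 * u`, which cancels when nonzero. -/
theorem rowMatrix_commute_of_ne (q u w : ℂ) {n : ℕ} (v : Fin n → ℂ) (h : w ≠ q ^ 2 * u) :
    rowMatrix q u v * rowMatrix q w v = rowMatrix q w v * rowMatrix q u v := by
  ext t b
  rw [rowMatrix_mul_apply, rowMatrix_mul_apply]
  have := congrFun (congrFun (intertwiner_mul_listProd q u w n v t b) (true, true)) (false, false)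
  simp only [Matrix.mul_apply, Fintype.sum_prod_type, Fintype.sum_bool, intertwiner,
    Matrix.of_apply] at this
  have h' := sub_ne_zero.mpr h
  apply mul_left_cancel₀ h'
  linear_combination this

theorem continuous_vertexMatrix {X : Type*} [TopologicalSpace X] (q : ℂ) {f g : X → ℂ}
    (hf : Continuous f) (hg : Continuous g) (t b : Bool) :
    Continuous fun x => vertexMatrix q (f x) (g x) t b := by
  refine continuous_matrix fun l r => ?_
  cases l <;> cases r <;> cases t <;> cases b <;>
    simp only [vertexMatrix, iceWeight, vertexState, Matrix.of_apply] <;> fun_prop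

theorem continuous_rowMatrix {X : Type*} [TopologicalSpace X] (q : ℂ) {n : ℕ} {f : X → ℂ}
    {g : X → Fin n → ℂ} (hf : Continuous f) (hg : Continuous g) :
    Continuous fun x => rowMatrix q (f x) (g x) := by
  refine continuous_matrix fun t b => ?_
  simp only [rowMatrix, Matrix.of_apply, List.ofFn_eq_map]
  exact (continuous_list_prod _ fun j _ =>
    continuous_vertexMatrix q hf ((continuous_apply j).comp hg) (t j) (b j)).matrix_elem true false

theorem continuous_icePolynomial {X : Type*} [TopologicalSpace X] (q : ℂ) {m n : ℕ}
    {f : X → Fin m → ℂ} {g : X → Fin n → ℂ} (hf : Continuous f) (hg : Continuous g)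
    (t b : Fin n → Bool) : Continuous fun x => icePolynomial q (f x) (g x) t b := by
  simp only [icePolynomial, List.ofFn_eq_map]
  exact (continuous_list_prod _ fun i _ =>
    continuous_rowMatrix q ((continuous_apply i).comp hf) hg).matrix_elem t b

theorem rowMatrix_commute (q u w : ℂ) {n : ℕ} (v : Fin n → ℂ) :
    Commute (rowMatrix q u v) (rowMatrix q w v) := by
  have hc : Continuous fun w => rowMatrix q w v :=
    continuous_rowMatrix q continuous_id continuous_const
  have := Continuous.ext_on (s := {w : ℂ | w ≠ q ^ 2 * u}) (dense_compl_singleton _)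
    ((continuous_const (y := rowMatrix q u v)).mul hc)
    (hc.mul (continuous_const (y := rowMatrix q u v)))
    fun w hw => rowMatrix_commute_of_ne q u w v hw
  exact congrFun this w

theorem icePolynomial_comp_perm (q : ℂ) {m n : ℕ} (u : Fin m → ℂ) (σ : Equiv.Perm (Fin m))
    (v : Fin n → ℂ) (t b : Fin n → Bool) :
    icePolynomial q (u ∘ σ) v t b = icePolynomial q u v t b := by
  have h := (Equiv.Perm.ofFn_comp_perm σ fun i => rowMatrix q (u i) v).prod_eq' ?_
  · exact congrFun (congrFun h t) b
  · rw [List.pairwise_ofFn]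
    exact fun i j _ => rowMatrix_commute q _ _ v

/-! ### Frozen vertices and special values of the first column parameter. -/

theorem sum_fin_succ_arrow {S M : Type*} [Fintype S] [AddCommMonoid M] {n : ℕ}
    (f : (Fin (n + 1) → S) → M) :
    ∑ c, f c = ∑ s : S, ∑ ρ : Fin n → S, f (Fin.cons s ρ) := by
  rw [← (Fin.consEquiv fun _ : Fin (n + 1) => S).sum_comp, Fintype.sum_prod_type]
  rfl

theorem rowMatrix_cons (q u z : ℂ) {n : ℕ} (v : Fin n → ℂ) (s s' : Bool) (σ τ : Fin n → Bool) :
    rowMatrix q u (Fin.cons z v : Fin (n + 1) → ℂ) (Fin.cons s σ : Fin (n + 1) → Bool)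
      (Fin.cons s' τ : Fin (n + 1) → Bool) =
      ∑ r : Bool, iceWeight q u z true r s' s *
        (List.ofFn fun j => vertexMatrix q u (v j) (σ j) (τ j)).prod r false := by
  simp [rowMatrix, List.ofFn_succ, Matrix.mul_apply, vertexMatrix]

/-- A vertex whose left arrow points right and whose bottom arrow points up can only be in state
three, which passes both arrows on. -/
theorem rowMatrix_cons_true_right (q u z : ℂ) {n : ℕ} (v : Fin n → ℂ) (s : Bool)
    (σ τ : Fin n → Bool) :
    rowMatrix q u (Fin.cons z v : Fin (n + 1) → ℂ) (Fin.cons s σ : Fin (n + 1) → Bool)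
      (Fin.cons true τ : Fin (n + 1) → Bool) =
      if s = true then (u - q ^ 2 * z) * rowMatrix q u v σ τ else 0 := by
  rw [rowMatrix_cons]
  cases s <;> simp [iceWeight, vertexState, rowMatrix]

theorem icePolynomial_cons_true_right (q z : ℂ) {n : ℕ} (v : Fin n → ℂ) :
    ∀ (m : ℕ) (u : Fin m → ℂ) (s : Bool) (σ τ : Fin n → Bool),
    icePolynomial q u (Fin.cons z v : Fin (n + 1) → ℂ) (Fin.cons s σ : Fin (n + 1) → Bool)
      (Fin.cons true τ : Fin (n + 1) → Bool) =
      if s = true then (∏ i, (u i - q ^ 2 * z)) * icePolynomial q u v σ τ else 0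
  | 0, u, s, σ, τ => by
    cases s <;> simp [icePolynomial, Matrix.one_apply]
  | m + 1, u, s, σ, τ => by
    have ih := icePolynomial_cons_true_right q z v m (fun i => u i.succ)
    simp only [icePolynomial] at ih
    simp only [icePolynomial, List.ofFn_succ, List.prod_cons, Matrix.mul_apply]
    rw [sum_fin_succ_arrow]
    simp only [ih, Fintype.sum_bool, if_true, rowMatrix_cons_true_right, Fin.prod_univ_succ]
    cases s
    · simp
    · simp only [if_true, Bool.false_eq_true, if_false, mul_zero, Finset.sum_const_zero, add_zero,
        Finset.mul_sum]
      exact Finset.sum_congr rfl fun ρ _ => by ring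

/-- A left arrow pointing left and a bottom arrow pointing down force state four, and this
propagates along the row. -/
theorem listProd_vertexMatrix_bot_false (q u : ℂ) :
    ∀ (n : ℕ) (v : Fin n → ℂ) (t : Fin n → Bool) (r : Bool),
    (List.ofFn fun j => vertexMatrix q u (v j) (t j) false).prod false r =
      if r = false ∧ t = (fun _ => false) then ∏ j, (u - q ^ 2 * v j) else 0
  | 0, v, t, r => by
    cases r <;> simp [eq_iff_true_of_subsingleton]
  | n + 1, v, t, r => by
    have ht : t = (fun _ => false) ↔ t 0 = false ∧ (fun j : Fin n => t j.succ) = fun _ => false := by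
      simp only [funext_iff]
      exact Fin.forall_fin_succ
    rw [List.ofFn_succ, List.prod_cons, Matrix.mul_apply, Fintype.sum_bool,
      listProd_vertexMatrix_bot_false q u n, Fin.prod_univ_succ]
    simp only [ht]
    cases h : t 0 <;> simp [vertexMatrix, iceWeight, vertexState]

/-- For equal parameters state six has weight zero, so the corner is in state one and the rest of
the row is frozen. -/
theorem rowMatrix_cons_self (q z : ℂ) {n : ℕ} (v : Fin n → ℂ) (s : Bool) (σ : Fin n → Bool) :
    rowMatrix q z (Fin.cons z v : Fin (n + 1) → ℂ) (Fin.cons s σ : Fin (n + 1) → Bool)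
      (fun _ => false) =
      if s = true ∧ σ = (fun _ => false) then (1 - q ^ 2) * z * ∏ j, (z - q ^ 2 * v j) else 0 := by
  have h : (fun _ => false : Fin (n + 1) → Bool) = Fin.cons false fun _ => false := by
    ext j
    refine Fin.cases ?_ (fun _ => ?_) j <;> simp
  rw [h, rowMatrix_cons, Fintype.sum_bool, listProd_vertexMatrix_bot_false]
  cases s <;> simp [iceWeight, vertexState]

theorem cons_const {S : Type*} (n : ℕ) (s : S) :
    (fun _ => s : Fin (n + 1) → S) = Fin.cons s fun _ => s := by
  ext j
  refine Fin.cases ?_ (fun _ => ?_) j <;> simp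

/-- If the parameter of the first column equals the one of the last row, then the vertex in the
bottom left corner is frozen, and with it the first column and the last row. -/
theorem icePolynomial_cons_last (q : ℂ) {n : ℕ} (u : Fin (n + 1) → ℂ) (v : Fin n → ℂ) :
    icePolynomial q u (Fin.cons (u (Fin.last n)) v : Fin (n + 1) → ℂ) (fun _ => true)
      (fun _ => false) =
      (1 - q ^ 2) * u (Fin.last n) * (∏ j, (u (Fin.last n) - q ^ 2 * v j)) *
        (∏ i, (Fin.init u i - q ^ 2 * u (Fin.last n))) *
        icePolynomial q (Fin.init u) v (fun _ => true) (fun _ => false) := by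
  have h := icePolynomial_cons_true_right q (u (Fin.last n)) v n (Fin.init u)
  have e : icePolynomial q u (Fin.cons (u (Fin.last n)) v : Fin (n + 1) → ℂ) (fun _ => true)
      (fun _ => false) = ∑ c, icePolynomial q (Fin.init u)
        (Fin.cons (u (Fin.last n)) v : Fin (n + 1) → ℂ) (fun _ => true) c *
        rowMatrix q (u (Fin.last n)) (Fin.cons (u (Fin.last n)) v : Fin (n + 1) → ℂ) c
          (fun _ => false) := by
    simp only [icePolynomial]
    rw [List.ofFn_succ_last, List.prod_append, List.prod_singleton, Matrix.mul_apply]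
    rfl
  rw [e, sum_fin_succ_arrow, Fintype.sum_bool]
  simp only [rowMatrix_cons_self]
  -- Above the last row only one state survives: first arrow up, all others down.
  rw [Finset.sum_eq_single fun _ => false, cons_const n true, h]
  · simp
    ring
  · intro σ _ hσ
    simp [hσ]
  · simp

/-- The first column turns from up to down somewhere. With the left arrow pointing right this needs
state one, whose weight is proportional to the column parameter. -/
theorem icePolynomial_cons_zero (q : ℂ) {n : ℕ} (v : Fin n → ℂ) :
    ∀ (m : ℕ) (u : Fin m → ℂ) (σ τ : Fin n → Bool),
    icePolynomial q u (Fin.cons 0 v : Fin (n + 1) → ℂ) (Fin.cons true σ : Fin (n + 1) → Bool)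
      (Fin.cons false τ : Fin (n + 1) → Bool) = 0
  | 0, u, σ, τ => by
    simp [icePolynomial]
  | m + 1, u, σ, τ => by
    have ih := icePolynomial_cons_zero q v m (fun i => u i.succ)
    simp only [icePolynomial] at ih
    simp only [icePolynomial, List.ofFn_succ, List.prod_cons, Matrix.mul_apply]
    rw [sum_fin_succ_arrow, Fintype.sum_bool]
    simp only [ih, mul_zero, Finset.sum_const_zero, zero_add]
    refine Finset.sum_eq_zero fun ρ _ => ?_
    rw [rowMatrix_cons]
    simp [iceWeight, vertexState]

/-! ### Polynomial functions of bounded degree and interpolation. -/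

/-- The function `f` is polynomial of degree at most `N`. -/
def IsPolynomialOfDegreeLE (N : ℕ) (f : ℂ → ℂ) : Prop :=
  ∃ p : Polynomial ℂ, p.natDegree ≤ N ∧ ∀ z, p.eval z = f z

namespace IsPolynomialOfDegreeLE

variable {M N : ℕ} {f g : ℂ → ℂ}

theorem const (c : ℂ) : IsPolynomialOfDegreeLE N fun _ => c :=
  ⟨Polynomial.C c, by simp, by simp⟩

theorem id : IsPolynomialOfDegreeLE 1 fun z => z :=
  ⟨Polynomial.X, Polynomial.natDegree_X_le, by simp⟩

theorem mul (hf : IsPolynomialOfDegreeLE M f) (hg : IsPolynomialOfDegreeLE N g) :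
    IsPolynomialOfDegreeLE (M + N) fun z => f z * g z := by
  obtain ⟨p, hp, hp'⟩ := hf
  obtain ⟨r, hr, hr'⟩ := hg
  exact ⟨p * r, Polynomial.natDegree_mul_le.trans (add_le_add hp hr), by simp [hp', hr']⟩

theorem const_mul (c : ℂ) (hf : IsPolynomialOfDegreeLE N f) :
    IsPolynomialOfDegreeLE N fun z => c * f z := by
  simpa using (const (N := 0) c).mul hf

theorem mul_const (c : ℂ) (hf : IsPolynomialOfDegreeLE N f) :
    IsPolynomialOfDegreeLE N fun z => f z * c := by
  simpa using hf.mul (const (N := 0) c)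

theorem sub (hf : IsPolynomialOfDegreeLE N f) (hg : IsPolynomialOfDegreeLE N g) :
    IsPolynomialOfDegreeLE N fun z => f z - g z := by
  obtain ⟨p, hp, hp'⟩ := hf
  obtain ⟨r, hr, hr'⟩ := hg
  exact ⟨p - r, (Polynomial.natDegree_sub_le p r).trans (max_le hp hr), by simp [hp', hr']⟩

theorem sum {ι : Type*} (s : Finset ι) {f : ι → ℂ → ℂ}
    (h : ∀ i ∈ s, IsPolynomialOfDegreeLE N (f i)) :
    IsPolynomialOfDegreeLE N fun z => ∑ i ∈ s, f i z := by
  choose! p hp hp' using h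
  refine ⟨∑ i ∈ s, p i, Polynomial.natDegree_sum_le_of_forall_le s p hp, fun z => ?_⟩
  rw [Polynomial.eval_finsetSum]
  exact Finset.sum_congr rfl fun i hi => hp' i hi z

theorem mono (h : M ≤ N) (hf : IsPolynomialOfDegreeLE M f) : IsPolynomialOfDegreeLE N f := by
  obtain ⟨p, hp, hp'⟩ := hf
  exact ⟨p, hp.trans h, hp'⟩

theorem prod {ι : Type*} (s : Finset ι) {f : ι → ℂ → ℂ}
    (h : ∀ i ∈ s, IsPolynomialOfDegreeLE 1 (f i)) :
    IsPolynomialOfDegreeLE s.card fun z => ∏ i ∈ s, f i z := by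
  choose! p hp hp' using h
  refine ⟨∏ i ∈ s, p i, (Polynomial.natDegree_prod_le s p).trans ?_, fun z => ?_⟩
  · simpa using Finset.sum_le_sum hp
  · rw [Polynomial.eval_prod]
    exact Finset.prod_congr rfl fun i hi => hp' i hi z

theorem pow (k : ℕ) : IsPolynomialOfDegreeLE k fun z => z ^ k :=
  ⟨Polynomial.X ^ k, Polynomial.natDegree_X_pow_le k, by simp⟩

theorem eq_of_injective (hf : IsPolynomialOfDegreeLE N f) (hg : IsPolynomialOfDegreeLE N g)
    {ι : Type*} [Fintype ι] {w : ι → ℂ} (hw : Function.Injective w) (hN : N < Fintype.card ι)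
    (h : ∀ i, f (w i) = g (w i)) : f = g := by
  obtain ⟨p, hp, hp'⟩ := hf
  obtain ⟨r, hr, hr'⟩ := hg
  have : p = r := by
    refine Polynomial.eq_of_degrees_lt_of_eval_index_eq Finset.univ hw.injOn ?_ ?_ fun i _ => ?_
    · exact Polynomial.degree_le_natDegree.trans_lt (by exact_mod_cast hp.trans_lt hN)
    · exact Polynomial.degree_le_natDegree.trans_lt (by exact_mod_cast hr.trans_lt hN)
    · rw [hp', hr', h]
  ext z
  rw [← hp', ← hr', this]

end IsPolynomialOfDegreeLE

theorem isPolynomialOfDegreeLE_iceWeight (q u : ℂ) (l r b t : Bool) :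
    IsPolynomialOfDegreeLE 1 fun z => iceWeight q u z l r b t := by
  have hs (c : ℂ) : IsPolynomialOfDegreeLE 1 fun z => u - c * z :=
    (IsPolynomialOfDegreeLE.const u).sub (IsPolynomialOfDegreeLE.id.const_mul c)
  have h1 := (IsPolynomialOfDegreeLE.id).const_mul (1 - q ^ 2)
  have h2 : IsPolynomialOfDegreeLE 1 fun _ => (1 - q ^ 2) * u := .const _
  have h3 := hs (q ^ 2)
  have h4 := (hs 1).const_mul q
  have h5 : IsPolynomialOfDegreeLE 1 fun _ => 0 := .const _
  simp only [one_mul] at h4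
  cases l <;> cases r <;> cases b <;> cases t <;> simp only [iceWeight, vertexState] <;> assumption

/-- Each row has exactly one vertex in the first column, with weight of degree at most one in `z`.
-/
theorem isPolynomialOfDegreeLE_icePolynomial (q : ℂ) {n : ℕ} (v : Fin n → ℂ) :
    ∀ (m : ℕ) (u : Fin m → ℂ) (t b : Fin (n + 1) → Bool),
    IsPolynomialOfDegreeLE m fun z => icePolynomial q u (Fin.cons z v : Fin (n + 1) → ℂ) t b
  | 0, u, t, b => by
    simpa [icePolynomial] using IsPolynomialOfDegreeLE.const _
  | m + 1, u, t, b => by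
    have ih := isPolynomialOfDegreeLE_icePolynomial q v m (fun i => u i.succ)
    have e : (fun z => icePolynomial q u (Fin.cons z v : Fin (n + 1) → ℂ) t b) = fun z =>
        ∑ c, rowMatrix q (u 0) (Fin.cons z v : Fin (n + 1) → ℂ) t c *
          icePolynomial q (fun i => u i.succ) (Fin.cons z v : Fin (n + 1) → ℂ) c b := by
      funext z
      simp only [icePolynomial, List.ofFn_succ, List.prod_cons, Matrix.mul_apply]
    rw [e]
    refine IsPolynomialOfDegreeLE.mono (add_comm 1 m).le
      (IsPolynomialOfDegreeLE.sum _ fun c _ => IsPolynomialOfDegreeLE.mul ?_ (ih c b))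
    rw [← Fin.cons_self_tail t, ← Fin.cons_self_tail c]
    simp only [rowMatrix_cons]
    exact IsPolynomialOfDegreeLE.sum _ fun r _ =>
      (isPolynomialOfDegreeLE_iceWeight q _ _ _ _ _).mul_const _

/-! ### From configurations to transfer matrices. -/

theorem iceWeight_eq_zero (q u v : ℂ) {l r b t : Bool} (h : ¬ ZeroDivergence l r b t) :
    iceWeight q u v l r b t = 0 := by
  rw [← vertexState_isSome_iff, Option.not_isSome_iff_eq_none] at h
  simp [iceWeight, h]

/-- Expanding the matrix products into paths sums over all arrows with the right boundary; those
violating zero divergence contribute zero. -/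
theorem sum_configurations (q : ℂ) {n : ℕ} (u v : Fin n → ℂ) :
    ∑ G ∈ configurations n, ∏ i : Fin n, ∏ j : Fin n, iceWeight q (u i) (v j)
        (G.horiz i j.castSucc) (G.horiz i j.succ) (G.vert i.succ j) (G.vert i.castSucc j) =
      icePolynomial q u v (fun _ => true) (fun _ => false) := by
  classical
  have hrow (u : ℂ) (t b : Fin n → Bool) : rowMatrix q u v t b =
      ∑ p : Fin (n + 1) → Bool, if p 0 = true ∧ p (Fin.last n) = false then
        ∏ j, iceWeight q u (v j) (p j.castSucc) (p j.succ) (b j) (t j) else 0 :=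
    listProd_apply_eq_sum_paths n _ _ _
  rw [icePolynomial, listProd_apply_eq_sum_paths, configurations, Finset.sum_filter,
    Fintype.sum_prod_type_right]
  refine Finset.sum_congr rfl fun V _ => ?_
  simp only [hrow, Finset.prod_univ_sum, Fintype.piFinset_univ]
  split_ifs with hV
  · refine Finset.sum_congr rfl fun H _ => ?_
    by_cases hH : ∀ i, H i 0 = true ∧ H i (Fin.last n) = false
    · simp only [hH, and_self, if_true]
      split_ifs with hG
      · rfl
      · simp only [IsSquareIce, not_and] at hG
        by_contra hne
        refine hG (fun i j => ?_) (fun i => (hH i).1) (fun i => (hH i).2)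
          (fun j => by simp [Arrows.vert, hV.1]) (fun j => by simp [Arrows.vert, hV.2])
        by_contra hz
        refine hne (Eq.symm (Finset.prod_eq_zero (Finset.mem_univ i)
          (Finset.prod_eq_zero (Finset.mem_univ j) (iceWeight_eq_zero q _ _ hz))))
    · rw [if_neg fun hG => hH fun i => ⟨hG.2.1 i, hG.2.2.1 i⟩]
      push Not at hH
      obtain ⟨i, hi⟩ := hH
      refine (Finset.prod_eq_zero (Finset.mem_univ i) (if_neg fun h => ?_)).symm
      exact hi h.1 h.2
  · refine Finset.sum_eq_zero fun H _ => if_neg fun hG => hV ⟨?_, ?_⟩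
    · ext j
      exact hG.2.2.2.1 j
    · ext j
      exact hG.2.2.2.2 j

theorem vertexWeight_eq {q : ℂ} (hq0 : q ≠ 0) (hq : q ^ 2 ≠ 1) {n : ℕ} (x y : Fin n → ℂ)
    (G : Arrows n) (i j : Fin n) :
    vertexWeight q x y G i j =
      (q ^ x i * q ^ y j * (q ^ 2 - 1))⁻¹ * iceWeight q (q ^ (2 * x i)) (q ^ (2 * y j))
        (G.horiz i j.castSucc) (G.horiz i j.succ) (G.vert i.succ j) (G.vert i.castSucc j) := by
  unfold vertexWeight
  generalize G.horiz i j.castSucc = l, G.horiz i j.succ = r, G.vert i.succ j = b,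
    G.vert i.castSucc j = t, x i = x, y j = y
  have hx : q ^ x ≠ 0 := by simp [Complex.cpow_eq_zero_iff, hq0]
  have hy : q ^ y ≠ 0 := by simp [Complex.cpow_eq_zero_iff, hq0]
  have ht : q ^ 2 - 1 ≠ 0 := sub_ne_zero.mpr hq
  have hqq : q - q⁻¹ = (q ^ 2 - 1) / q := by field_simp
  have h2 (z : ℂ) : q ^ (2 * z) = (q ^ z) ^ 2 := by
    rw [← Complex.cpow_nat_mul]
    norm_num
  have e1 : q ^ (x - y) = q ^ x / q ^ y := Complex.cpow_sub _ _ hq0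
  have e2 : q ^ (-(x - y)) = q ^ y / q ^ x := by rw [neg_sub, Complex.cpow_sub _ _ hq0]
  have e3 : q ^ (x - y - 1) = q ^ x / q ^ y / q := by
    rw [Complex.cpow_sub _ _ hq0, e1, Complex.cpow_one]
  have e4 : q ^ (-(x - y - 1)) = q * (q ^ y / q ^ x) := by
    rw [Complex.cpow_neg, e3]
    field_simp
  cases l <;> cases r <;> cases b <;> cases t <;>
    simp only [vertexState, iceWeight, stateWeight, bracket, e1, e2, e3, e4, h2, hqq, mul_zero] <;>
    field_simp <;> ring

theorem partitionFunction_eq {q : ℂ} (hq0 : q ≠ 0) (hq : q ^ 2 ≠ 1) {n : ℕ} (x y : Fin n → ℂ) :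
    partitionFunction q x y =
      (∏ i, ∏ j, (q ^ x i * q ^ y j * (q ^ 2 - 1))⁻¹) *
        icePolynomial q (fun i => q ^ (2 * x i)) (fun j => q ^ (2 * y j)) (fun _ => true)
          (fun _ => false) := by
  rw [← sum_configurations, Finset.mul_sum, partitionFunction]
  refine Finset.sum_congr rfl fun G _ => ?_
  simp only [weight, vertexWeight_eq hq0 hq, Finset.prod_mul_distrib]

/-! ### The determinant with powers of the column parameters. -/

theorem elemSymm_natCast {n : ℕ} (u : Fin n → ℂ) (k : ℕ) :
    elemSymm u k = (Finset.univ.val.map u).esymm k := by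
  rw [elemSymm, if_neg (by simp), Int.toNat_natCast, 
    ← MvPolynomial.aeval_esymm_eq_multiset_esymm (Fin n) ℂ]
  rfl

theorem elemSymm_eq_zero_of_neg {n : ℕ} (u : Fin n → ℂ) {k : ℤ} (h : k < 0) : elemSymm u k = 0 :=
  if_pos h

theorem elemSymm_eq_zero_of_lt {n : ℕ} (u : Fin n → ℂ) {k : ℤ} (h : n < k) : elemSymm u k = 0 := by
  lift k to ℕ using by omega
  rw [elemSymm_natCast, Multiset.esymm, Multiset.powersetCard_eq_empty]
  · simp
  · simpa using h

theorem elemSymm_comp_perm {n : ℕ} (u : Fin n → ℂ) (σ : Equiv.Perm (Fin n)) (k : ℤ) :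
    elemSymm (u ∘ σ) k = elemSymm u k := by
  rcases lt_or_ge k 0 with h | h
  · simp [elemSymm, h]
  · lift k to ℕ using h
    rw [elemSymm_natCast, elemSymm_natCast, ← Multiset.map_map]
    congr 2
    simp

theorem eMatrix_comp_perm (t : ℂ) {n : ℕ} (u : Fin n → ℂ) (σ : Equiv.Perm (Fin n)) :
    eMatrix t (u ∘ σ) = eMatrix t u := by
  simp only [eMatrix, elemSymm_comp_perm]

theorem prod_sub_eq_sum_elemSymm {n : ℕ} (u : Fin n → ℂ) (z : ℂ) :
    ∏ i, (z - u i) = ∑ m ∈ Finset.range (n + 1),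
      z ^ m * ((-1) ^ ((n : ℤ) - m) * elemSymm u ((n : ℤ) - m)) := by
  have h := congrArg (Polynomial.eval z)
    (Multiset.prod_X_sub_X_eq_sum_esymm ((Finset.univ : Finset (Fin n)).val.map u))
  rw [Multiset.map_map, Polynomial.eval_multiset_prod, Multiset.map_map,
    Polynomial.eval_finsetSum] at h
  simp only [Function.comp_def, Polynomial.eval_sub, Polynomial.eval_X, Polynomial.eval_C,
    Multiset.card_map, Finset.card_val, Finset.card_univ, Fintype.card_fin, Polynomial.eval_mul,
    Polynomial.eval_pow, Polynomial.eval_neg, Polynomial.eval_one] at h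
  refine h.trans ?_
  rw [← Finset.sum_range_reflect]
  refine Finset.sum_congr rfl fun m hm => ?_
  have hm' : m ≤ n := by simpa [Nat.lt_succ_iff] using hm
  have e : (n : ℤ) - m = ((n - m : ℕ) : ℤ) := by omega
  rw [e, elemSymm_natCast, zpow_natCast]
  have e1 : n + 1 - 1 - m = n - m := by omega
  have e2 : n - (n - m) = m := by omega
  rw [e1, e2]
  ring

/-- The coefficients `e_m(U)` with signs assemble into `∏ (X - u i)`, evaluated at `t * v` and at
`v`; the factor `v` shifts the exponent by one. -/
theorem sum_pow_mul_eMatrix {t : ℂ} (ht : t ≠ 1) {n : ℕ} (u : Fin n → ℂ) (c : Fin n) (v : ℂ) :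
    (t - 1) * v * ∑ b : Fin (2 * n - 1), v ^ (b : ℕ) * eMatrix t u b c =
      v ^ (c : ℕ) * (∏ i, (t * v - u i) - t ^ (c : ℕ) * ∏ i, (v - u i)) := by
  have ht' : t - 1 ≠ 0 := sub_ne_zero.mpr ht
  let g : ℕ → ℂ := fun k => v ^ k * ((t ^ ((k : ℤ) - c) - t ^ (c : ℕ)) *
    (-1) ^ ((n : ℤ) - k + c) * elemSymm u ((n : ℤ) - k + c))
  have h1 : (t - 1) * v * ∑ b : Fin (2 * n - 1), v ^ (b : ℕ) * eMatrix t u b c =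
      ∑ k ∈ Finset.range (2 * n - 1), g (k + 1) := by
    rw [← Fin.sum_univ_eq_sum_range (fun k => g (k + 1)), Finset.mul_sum]
    refine Finset.sum_congr rfl fun b _ => ?_
    have e1 : ((b : ℕ) : ℤ) + 1 - ((c : ℕ) + 1) + 1 = ((b + 1 : ℕ) : ℤ) - c := by push_cast; ring
    have e2 : (((c : ℕ) : ℤ) + 1 - 1) = (c : ℕ) := by ring
    have e3 : (n : ℤ) - ((b : ℕ) + 1) + ((c : ℕ) + 1) - 1 = (n : ℤ) - ((b + 1 : ℕ) : ℤ) + c := by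
      push_cast; ring
    simp only [g, eMatrix, Matrix.of_apply, e1, e2, e3, zpow_natCast]
    field_simp
    ring
  -- The shifted sum starts at exponent 1; the missing term vanishes by cancellation of powers of
  -- `t` if `c = 0`, and because `e_{n + c} = 0` otherwise.
  have h2 : g 0 = 0 := by
    rcases Nat.eq_zero_or_pos (c : ℕ) with hc | hc
    · simp [g, hc]
    · simp only [g]
      rw [elemSymm_eq_zero_of_lt u (by push_cast; omega)]
      simp
  -- Only exponents from `c` to `c + n` carry an elementary symmetric function of index between `0`
  -- and `n`.
  have h3 : 2 * n = c + ((n + 1) + (n - 1 - c)) := by omega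
  have h4 : ∑ k ∈ Finset.range (2 * n - 1), g (k + 1) = ∑ k ∈ Finset.range (2 * n), g k := by
    obtain ⟨m, hm⟩ : ∃ m, 2 * n = m + 1 := ⟨2 * n - 1, by omega⟩
    rw [hm, Finset.sum_range_succ', h2, add_zero, Nat.add_sub_cancel]
  rw [h1, h4, h3, Finset.sum_range_add, Finset.sum_range_add, Finset.sum_eq_zero,
    Finset.sum_eq_zero (s := Finset.range (n - 1 - c)), zero_add, add_zero,
    prod_sub_eq_sum_elemSymm, prod_sub_eq_sum_elemSymm, Finset.mul_sum, ← Finset.sum_sub_distrib,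
    Finset.mul_sum]
  · refine Finset.sum_congr rfl fun m _ => ?_
    have e1 : (((c : ℕ) + m : ℕ) : ℤ) - c = m := by push_cast; ring
    have e2 : (n : ℤ) - (((c : ℕ) + m : ℕ) : ℤ) + c = n - m := by push_cast; ring
    simp only [g, e1, e2, zpow_natCast]
    ring
  · intro k _
    simp only [g]
    rw [elemSymm_eq_zero_of_neg u (by push_cast; omega)]
    simp
  · intro k hk
    simp only [g]
    rw [Finset.mem_range] at hk
    rw [elemSymm_eq_zero_of_lt u (by omega)]
    simp

/-- The `n × (2 n - 1)` matrix of powers `v_j ^ b`. -/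
def powerMatrix {n : ℕ} (v : Fin n → ℂ) : Matrix (Fin n) (Fin (2 * n - 1)) ℂ :=
  Matrix.of fun j b => v j ^ (b : ℕ)

theorem powerMatrix_mul_eMatrix {t : ℂ} (ht : t ≠ 1) {n : ℕ} (u v : Fin n → ℂ) (j c : Fin n) :
    (t - 1) * v j * (powerMatrix v * eMatrix t u) j c =
      v j ^ (c : ℕ) * (∏ i, (t * v j - u i) - t ^ (c : ℕ) * ∏ i, (v j - u i)) := by
  rw [Matrix.mul_apply, ← sum_pow_mul_eMatrix ht]
  rfl

/-- Subtracting `u (Fin.last n)` times the preceding column pulls the factor `(w j - u) * (t * w j -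
u)` out of each row, with `u` the last row parameter. It vanishes in row 0, and the remaining minor
is the determinant of size `n`. -/
theorem det_powerMatrix_mul_eMatrix_cons_last {t : ℂ} (ht : t ≠ 1) {n : ℕ} (u : Fin (n + 1) → ℂ)
    (v : Fin n → ℂ) (hu : u (Fin.last n) ≠ 0) (hv : ∀ j, v j ≠ 0) :
    (powerMatrix (Fin.cons (u (Fin.last n)) v : Fin (n + 1) → ℂ) * eMatrix t u).det =
      (∏ i, (t * u (Fin.last n) - Fin.init u i)) *
        (∏ j, ((v j - u (Fin.last n)) * (t * v j - u (Fin.last n)))) *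
        (powerMatrix v * eMatrix t (Fin.init u)).det := by
  have ht' : t - 1 ≠ 0 := sub_ne_zero.mpr ht
  set w : Fin (n + 1) → ℂ := Fin.cons (u (Fin.last n)) v with hw
  set A := powerMatrix w * eMatrix t u with hA
  have hw0 : ∀ j, w j ≠ 0 := by
    intro j
    refine Fin.cases ?_ (fun j => ?_) j
    · simpa [hw] using hu
    · simpa [hw] using hv j
  have hcol (j : Fin (n + 1)) (c : Fin n) :
      (t - 1) * w j * (A j c.succ - u (Fin.last n) * A j c.castSucc) =
        (w j - u (Fin.last n)) * (t * w j - u (Fin.last n)) * (w j ^ (c : ℕ) *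
          (∏ i, (t * w j - Fin.init u i) - t ^ (c : ℕ) * ∏ i, (w j - Fin.init u i))) := by
    have h1 := powerMatrix_mul_eMatrix ht u w j c.succ
    have h2 := powerMatrix_mul_eMatrix ht u w j c.castSucc
    rw [← hA] at h1 h2
    rw [Fin.prod_univ_castSucc, Fin.prod_univ_castSucc] at h1 h2
    simp only [Fin.val_succ, Fin.val_castSucc] at h1 h2
    simp only [Fin.init]
    linear_combination h1 - u (Fin.last n) * h2
  let B : Matrix (Fin (n + 1)) (Fin (n + 1)) ℂ := Matrix.of fun j =>
    Fin.cons (A j 0) fun c => A j c.succ - u (Fin.last n) * A j c.castSucc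
  have hdet : A.det = B.det :=
    Matrix.det_eq_of_forall_col_eq_smul_add_pred (fun _ => u (Fin.last n)) (fun j => by simp [B])
      (fun j c => by simp [B])
  have hB0 (c : Fin n) : B 0 c.succ = 0 := by
    have h := hcol 0 c
    rw [show w 0 = u (Fin.last n) from rfl, sub_self, zero_mul, zero_mul] at h
    exact (mul_eq_zero.mp h).resolve_left (mul_ne_zero ht' hu)
  have hB00 : B 0 0 = ∏ i, (t * u (Fin.last n) - Fin.init u i) := by
    have h := powerMatrix_mul_eMatrix ht u w 0 0
    rw [← hA, show w 0 = u (Fin.last n) from rfl, Fin.prod_univ_castSucc,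
      Fin.prod_univ_castSucc] at h
    apply mul_left_cancel₀ (mul_ne_zero ht' hu)
    simp only [B, Matrix.of_apply, Fin.cons_zero, Fin.init]
    rw [h]
    simp
    ring
  have hBs (j c : Fin n) : B j.succ c.succ =
      ((v j - u (Fin.last n)) * (t * v j - u (Fin.last n))) *
        (powerMatrix v * eMatrix t (Fin.init u)) j c := by
    have h := hcol j.succ c
    rw [show w j.succ = v j from rfl, ← powerMatrix_mul_eMatrix ht] at h
    apply mul_left_cancel₀ (mul_ne_zero ht' (hv j))
    simp only [B, Matrix.of_apply, Fin.cons_succ]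
    rw [h]
    ring
  rw [hdet, Matrix.det_succ_row_zero, Finset.sum_eq_single 0]
  · have hsub : B.submatrix Fin.succ Fin.succ = Matrix.of fun j c =>
        ((v j - u (Fin.last n)) * (t * v j - u (Fin.last n))) *
          (powerMatrix v * eMatrix t (Fin.init u)) j c :=
      Matrix.ext fun j c => hBs j c
    rw [Fin.succAbove_zero, hsub,
      Matrix.det_mul_column (fun j => (v j - u (Fin.last n)) * (t * v j - u (Fin.last n))), hB00]
    simp only [Fin.val_zero, pow_zero, one_mul, mul_assoc]
  · intro c _ hc
    obtain ⟨c, rfl⟩ := Fin.exists_succ_eq.mpr hc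
    simp [hB0]
  · simp

/-- Only row 0 involves `z`, through powers of exponent at most `2 * n`. -/
theorem isPolynomialOfDegreeLE_det_powerMatrix (t : ℂ) {n : ℕ} (u : Fin (n + 1) → ℂ)
    (v : Fin n → ℂ) :
    IsPolynomialOfDegreeLE (2 * n) fun z =>
      (powerMatrix (Fin.cons z v : Fin (n + 1) → ℂ) * eMatrix t u).det := by
  simp only [Matrix.det_succ_row_zero]
  refine IsPolynomialOfDegreeLE.sum _ fun c _ => ?_
  have h (z : ℂ) : ((powerMatrix (Fin.cons z v : Fin (n + 1) → ℂ) * eMatrix t u).submatrix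
      Fin.succ c.succAbove) = (((Matrix.of fun (j : Fin n) (b : Fin (2 * (n + 1) - 1)) =>
        v j ^ (b : ℕ)) * eMatrix t u).submatrix id c.succAbove) := by
    ext j c
    simp [Matrix.mul_apply, powerMatrix]
  simp only [h]
  refine IsPolynomialOfDegreeLE.mul_const _ (IsPolynomialOfDegreeLE.const_mul _ ?_)
  simp only [Matrix.mul_apply]
  refine IsPolynomialOfDegreeLE.sum _ fun b _ => IsPolynomialOfDegreeLE.mul_const _ ?_
  simpa [powerMatrix] using (IsPolynomialOfDegreeLE.pow (b : ℕ)).mono (by omega)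

/-! ### From powers to complete homogeneous symmetric functions. -/

theorem eval_hsymm {σ : Type*} [Fintype σ] [DecidableEq σ] (f : σ → ℂ) (k : ℕ) :
    MvPolynomial.eval f (MvPolynomial.hsymm σ ℂ k) = ∑ s : Sym σ k, (s.1.map f).prod := by
  simp [MvPolynomial.hsymm, map_multiset_prod, Multiset.map_map]

/-- Monomials are split according to whether they contain the variable `none`. -/
theorem eval_hsymm_option {σ : Type*} [Fintype σ] [DecidableEq σ] (f : Option σ → ℂ) (k : ℕ) :
    MvPolynomial.eval f (MvPolynomial.hsymm (Option σ) ℂ (k + 1)) =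
      f none * MvPolynomial.eval f (MvPolynomial.hsymm (Option σ) ℂ k) +
        MvPolynomial.eval (f ∘ some) (MvPolynomial.hsymm σ ℂ (k + 1)) := by
  rw [eval_hsymm, eval_hsymm, eval_hsymm, ← (symOptionSuccEquiv (α := σ)).symm.sum_comp,
    Fintype.sum_sum_type, Finset.mul_sum]
  congr 1
  · refine Finset.sum_congr rfl fun s _ => ?_
    change (Multiset.map f (none ::ₘ s.1)).prod = _
    simp
  · refine Finset.sum_congr rfl fun s _ => ?_
    simp [symOptionSuccEquiv, SymOptionSuccEquiv.decode, Multiset.map_map]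

theorem eval_hsymm_cons {n : ℕ} (v : Fin (n + 1) → ℂ) (k : ℕ) :
    MvPolynomial.eval v (MvPolynomial.hsymm (Fin (n + 1)) ℂ (k + 1)) =
      v 0 * MvPolynomial.eval v (MvPolynomial.hsymm (Fin (n + 1)) ℂ k) +
        MvPolynomial.eval (Fin.tail v) (MvPolynomial.hsymm (Fin n) ℂ (k + 1)) := by
  have h := eval_hsymm_option (v ∘ (finSuccEquiv n).symm) k
  rw [← MvPolynomial.eval_rename, ← MvPolynomial.eval_rename, MvPolynomial.rename_hsymm,
    MvPolynomial.rename_hsymm] at h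
  rw [h]
  simp [Fin.tail_def, Function.comp_def]

theorem complSymm_natCast {n : ℕ} (v : Fin n → ℂ) (k : ℕ) :
    complSymm v k = MvPolynomial.eval v (MvPolynomial.hsymm (Fin n) ℂ k) := by
  rw [complSymm, if_neg (by simp), Int.toNat_natCast]

theorem complSymm_eq_zero_of_neg {n : ℕ} (v : Fin n → ℂ) {k : ℤ} (h : k < 0) :
    complSymm v k = 0 :=
  if_pos h

theorem complSymm_zero {n : ℕ} (v : Fin n → ℂ) : complSymm v 0 = 1 := by
  simp [complSymm]

/-- The generating series of the complete homogeneous symmetric functions. -/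
def complSeries {n : ℕ} (v : Fin n → ℂ) : PowerSeries ℂ :=
  PowerSeries.mk fun k => complSymm v k

theorem complSeries_mul_one_sub {n : ℕ} (v : Fin (n + 1) → ℂ) :
    complSeries v * (1 - PowerSeries.C (v 0) * PowerSeries.X) = complSeries (Fin.tail v) := by
  ext k
  rw [mul_sub, mul_one, mul_left_comm]
  rcases k with _ | k
  · simp [complSeries, complSymm_zero]
  · simp only [complSeries, map_sub, PowerSeries.coeff_mk, PowerSeries.coeff_C_mul,
      PowerSeries.coeff_succ_mul_X, complSymm_natCast, eval_hsymm_cons]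
    ring

theorem complSeries_mul_prod : ∀ {n : ℕ} (v : Fin n → ℂ),
    complSeries v * ∏ i, (1 - PowerSeries.C (v i) * PowerSeries.X) = 1
  | 0, v => by
    ext k
    rcases k with _ | k
    · simp [complSeries, complSymm_zero]
    · simp [complSeries, complSymm_natCast, eval_hsymm, PowerSeries.coeff_one]
  | n + 1, v => by
    rw [Fin.prod_univ_succ, ← mul_assoc, complSeries_mul_one_sub]
    exact complSeries_mul_prod (Fin.tail v)

theorem geometric_mul_one_sub (a : ℂ) :
    (PowerSeries.mk fun k => a ^ k) * (1 - PowerSeries.C a * PowerSeries.X) = 1 := by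
  ext k
  rw [mul_sub, mul_one, mul_left_comm]
  rcases k with _ | k
  · simp
  · simp [PowerSeries.coeff_succ_mul_X, PowerSeries.coeff_one]
    ring

/-- The polynomial `∏_{k ≠ j} (1 - v_k X)`. -/
def coprod {n : ℕ} (v : Fin n → ℂ) (j : Fin n) : Polynomial ℂ :=
  ∏ k ∈ Finset.univ.erase j, (1 - Polynomial.C (v k) * Polynomial.X)

theorem natDegree_coprod_lt {n : ℕ} (v : Fin n → ℂ) (j : Fin n) : (coprod v j).natDegree < n := by
  have h : (coprod v j).natDegree ≤ ∑ k ∈ Finset.univ.erase j, 1 := by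
    refine (Polynomial.natDegree_prod_le _ _).trans (Finset.sum_le_sum fun k _ => ?_)
    compute_degree
  have := j.pos
  simp at h
  omega

theorem coprod_mul_complSeries {n : ℕ} (v : Fin n → ℂ) (j : Fin n) :
    (coprod v j : PowerSeries ℂ) * complSeries v = PowerSeries.mk fun k => v j ^ k := by
  have h1 := complSeries_mul_prod v
  rw [← Finset.mul_prod_erase _ _ (Finset.mem_univ j)] at h1
  have h2 : (coprod v j : PowerSeries ℂ) =
      ∏ k ∈ Finset.univ.erase j, (1 - PowerSeries.C (v k) * PowerSeries.X) := by
    rw [coprod, ← Polynomial.coeToPowerSeries.ringHom_apply, map_prod]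
    simp
  rw [h2]
  have h3 := geometric_mul_one_sub (v j)
  linear_combination (-(∏ k ∈ Finset.univ.erase j, (1 - PowerSeries.C (v k) * PowerSeries.X)) *
    complSeries v) * h3 + (PowerSeries.mk fun k => v j ^ k) * h1

/-- Coefficient comparison in `coprod_mul_complSeries`; since `coprod v j` has degree below `n`, the
same `n` coefficients serve for every exponent `b`. -/
theorem pow_eq_sum_coprod_coeff {n : ℕ} (v : Fin n → ℂ) (j : Fin n) (b : ℕ) :
    v j ^ b = ∑ i : Fin n, (coprod v j).coeff i * complSymm v ((b : ℤ) - i) := by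
  have h := congrArg (PowerSeries.coeff b) (coprod_mul_complSeries v j)
  rw [PowerSeries.coeff_mk, PowerSeries.coeff_mul,
    Finset.Nat.sum_antidiagonal_eq_sum_range_succ_mk] at h
  rw [← h, Fin.sum_univ_eq_sum_range (fun i => (coprod v j).coeff i * complSymm v ((b : ℤ) - i))]
  have e : ∑ i ∈ Finset.range (b + 1), (coprod v j).coeff i * complSymm v ((b : ℤ) - i) =
      ∑ i ∈ Finset.range n, (coprod v j).coeff i * complSymm v ((b : ℤ) - i) := by
    rcases le_total (b + 1) n with hb | hb
    · refine Finset.sum_subset (Finset.range_mono hb) fun i _ hi => ?_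
      rw [complSymm_eq_zero_of_neg, mul_zero]
      simp at hi
      omega
    · refine (Finset.sum_subset (Finset.range_mono hb) fun i _ hi => ?_).symm
      rw [Polynomial.coeff_eq_zero_of_natDegree_lt, zero_mul]
      refine (natDegree_coprod_lt v j).trans_le ?_
      simpa using hi
  rw [← e]
  refine Finset.sum_congr rfl fun i hi => ?_
  have hi' : i ≤ b := by simpa [Nat.lt_succ_iff] using hi
  simp [complSeries, Nat.cast_sub hi']

theorem det_powerMatrix_mul {n : ℕ} (v : Fin n → ℂ) (E : Matrix (Fin (2 * n - 1)) (Fin n) ℂ) :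
    (powerMatrix v * E).det = (Matrix.vandermonde v).det * (hMatrix v * E).det := by
  let K : Matrix (Fin n) (Fin n) ℂ := Matrix.of fun j i => (coprod v j).coeff i
  -- The first `n` columns of `hMatrix v`: unitriangular, so `K` has the Vandermonde determinant.
  let H : Matrix (Fin n) (Fin n) ℂ := Matrix.of fun i b => complSymm v ((b : ℤ) - (i : ℕ))
  have h1 : powerMatrix v = K * hMatrix v := by
    ext j b
    simp [powerMatrix, K, hMatrix, Matrix.mul_apply, pow_eq_sum_coprod_coeff v j b]
  have h2 : Matrix.vandermonde v = K * H := by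
    ext j b
    simp [K, H, Matrix.mul_apply, Matrix.vandermonde_apply, pow_eq_sum_coprod_coeff v j b]
  have h3 : H.det = 1 := by
    rw [Matrix.det_of_isUpperTriangular]
    · simp [H, complSymm_zero]
    · intro i j hij
      refine complSymm_eq_zero_of_neg v ?_
      simp at hij
      omega
  rw [h1, Matrix.mul_assoc, Matrix.det_mul, h2, Matrix.det_mul, h3, mul_one]

/-! ### The identity for generic parameters. -/

theorem det_vandermonde_cons {n : ℕ} (z : ℂ) (v : Fin n → ℂ) :
    (Matrix.vandermonde (Fin.cons z v : Fin (n + 1) → ℂ)).det =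
      (∏ j, (v j - z)) * (Matrix.vandermonde v).det := by
  simp only [Matrix.det_vandermonde, Fin.prod_univ_succ, Fin.prod_Ioi_zero, Fin.prod_Ioi_succ,
    Fin.cons_zero, Fin.cons_succ]

theorem prod_sub_comm {n : ℕ} (a b : Fin n → ℂ) :
    ∏ i, (a i - b i) = (-1) ^ n * ∏ i, (b i - a i) := by
  simp only [← neg_sub (b _), Finset.prod_neg, Finset.card_univ, Fintype.card_fin]

/-- Induction on the size by interpolation in the first column parameter. The assumptions on `u` and
`v` make the nodes distinct and pass to the smaller instance. -/
theorem icePolynomial_mul_det_vandermonde_of_injective {q : ℂ} (hq : q ^ 2 ≠ 1) :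
    ∀ {n : ℕ} (u v : Fin n → ℂ), Function.Injective u → Function.Injective v →
      (∀ i, u i ≠ 0) → (∀ j, v j ≠ 0) → (∀ i j, u i ≠ v j) →
      icePolynomial q u v (fun _ => true) (fun _ => false) * (Matrix.vandermonde v).det =
        (1 - q ^ 2) ^ n * (∏ j, v j) * (powerMatrix v * eMatrix (q ^ 2) u).det
  | 0, u, v, _, _, _, _, _ => by
    simp [icePolynomial, Matrix.one_apply, eq_iff_true_of_subsingleton]
  | n + 1, u, v, hu, hv, hu0, hv0, huv => by
    obtain ⟨z, w, rfl⟩ : ∃ z w, v = Fin.cons z w := ⟨v 0, Fin.tail v, (Fin.cons_self_tail v).symm⟩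
    have hw : Function.Injective w := fun i j h => by
      simpa using @hv i.succ j.succ (by simpa using h)
    have hw0 (j) : w j ≠ 0 := by simpa using hv0 j.succ
    have huw (i j) : u i ≠ w j := by simpa using huv i j.succ
    let f : ℂ → ℂ := fun z =>
      icePolynomial q u (Fin.cons z w : Fin (n + 1) → ℂ) (fun _ => true) (fun _ => false) *
        ((∏ j, (w j - z)) * (Matrix.vandermonde w).det)
    let g : ℂ → ℂ := fun z => (1 - q ^ 2) ^ (n + 1) * (z * ∏ j, w j) *
      (powerMatrix (Fin.cons z w : Fin (n + 1) → ℂ) * eMatrix (q ^ 2) u).det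
    have hf : IsPolynomialOfDegreeLE (2 * n + 1) f := by
      have h1 : IsPolynomialOfDegreeLE n fun z => ∏ j, (w j - z) := by
        simpa using IsPolynomialOfDegreeLE.prod (Finset.univ : Finset (Fin n)) fun j _ =>
          (IsPolynomialOfDegreeLE.const (w j)).sub IsPolynomialOfDegreeLE.id
      exact ((isPolynomialOfDegreeLE_icePolynomial q w (n + 1) u _ _).mul
        (h1.mul_const _)).mono (by omega)
    have hg : IsPolynomialOfDegreeLE (2 * n + 1) g :=
      (((IsPolynomialOfDegreeLE.id.mul_const _).const_mul _).mul
        (isPolynomialOfDegreeLE_det_powerMatrix (q ^ 2) u w)).mono (by omega)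
    -- The `2 * n + 2` nodes: zero, the row parameters and the other column parameters.
    let p : Option (Fin (n + 1) ⊕ Fin n) → ℂ := fun o => o.elim 0 (Sum.elim u w)
    have hp : Function.Injective p := by
      rintro (_ | i | i) (_ | j | j) h <;> simp only [p, Option.elim, Sum.elim_inl, Sum.elim_inr] at h
      · rfl
      · exact absurd h.symm (hu0 j)
      · exact absurd h.symm (hw0 j)
      · exact absurd h (hu0 i)
      · rw [hu h]
      · exact absurd h (huw i j)
      · exact absurd h (hw0 i)
      · exact absurd h.symm (huw j i)
      · rw [hw h]
    have hfg : f = g := by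
      refine hf.eq_of_injective hg hp (by simp; omega) ?_
      rintro (_ | i | j)
      · have h := icePolynomial_cons_zero q w (n + 1) u (fun _ => true) fun _ => false
        rw [← cons_const, ← cons_const] at h
        simp [f, g, p, h]
      -- Both sides are symmetric in `u`, so `u i` may be moved to the last row, where the
      -- recursions apply.
      · have hσ : Function.Injective (u ∘ Equiv.swap i (Fin.last n)) :=
          hu.comp (Equiv.injective _)
        have hi : (u ∘ Equiv.swap i (Fin.last n)) (Fin.last n) = u i := by simp
        have hr := icePolynomial_cons_last q (u ∘ Equiv.swap i (Fin.last n)) w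
        have hd := det_powerMatrix_mul_eMatrix_cons_last hq (u ∘ Equiv.swap i (Fin.last n)) w
          (hu0 _) hw0
        have ih := icePolynomial_mul_det_vandermonde_of_injective hq
          (Fin.init (u ∘ Equiv.swap i (Fin.last n))) w (hσ.comp (Fin.castSucc_injective n)) hw
          (fun _ => hu0 _) hw0 (fun _ _ => huw _ _)
        rw [hi, icePolynomial_comp_perm, prod_sub_comm (fun _ => u i),
          prod_sub_comm _ (fun _ => q ^ 2 * u i)] at hr
        rw [hi, eMatrix_comp_perm, Finset.prod_mul_distrib] at hd
        have hs : ((-1 : ℂ) ^ n) * (-1) ^ n = 1 := by rw [← mul_pow]; simp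
        simp only [f, g, p, Option.elim, Sum.elim_inl, hr, hd]
        set P := icePolynomial q (Fin.init (u ∘ Equiv.swap i (Fin.last n))) w (fun _ => true)
          fun _ => false
        set A := ∏ j, (q ^ 2 * w j - u i)
        set B := ∏ j, (q ^ 2 * u i - Fin.init (u ∘ Equiv.swap i (Fin.last n)) j)
        set C := ∏ j, (w j - u i)
        linear_combination (1 - q ^ 2) * u i * A * B * C * ih +
          (1 - q ^ 2) * u i * A * B * C * P * (Matrix.vandermonde w).det * hs
      · have h1 : ∏ k, (w k - w j) = 0 := Finset.prod_eq_zero (Finset.mem_univ j) (sub_self _)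
        have h2 : (powerMatrix (Fin.cons (w j) w : Fin (n + 1) → ℂ) * eMatrix (q ^ 2) u).det = 0 :=
          Matrix.det_zero_of_row_eq (Fin.succ_ne_zero j).symm
            (by ext c; simp [Matrix.mul_apply, powerMatrix])
        simp [f, g, p, h1, h2]
    have := congrFun hfg z
    simp only [f, g] at this
    rw [det_vandermonde_cons, this]
    simp [Fin.prod_univ_succ]

theorem icePolynomial_eq_of_injective {q : ℂ} (hq : q ^ 2 ≠ 1) {n : ℕ} (u v : Fin n → ℂ)
    (hu : Function.Injective u) (hv : Function.Injective v) (hu0 : ∀ i, u i ≠ 0)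
    (hv0 : ∀ j, v j ≠ 0) (huv : ∀ i j, u i ≠ v j) :
    icePolynomial q u v (fun _ => true) (fun _ => false) =
      (1 - q ^ 2) ^ n * (∏ j, v j) * lascouxDet (q ^ 2) v u := by
  have h := icePolynomial_mul_det_vandermonde_of_injective hq u v hu hv hu0 hv0 huv
  rw [det_powerMatrix_mul] at h
  apply mul_right_cancel₀ (Matrix.det_vandermonde_ne_zero_iff.mpr hv)
  rw [h, lascouxDet]
  ring

/-! ### Removing genericity by continuity. -/

theorem continuous_lascouxDet {X : Type*} [TopologicalSpace X] (t : ℂ) {n : ℕ}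
    {f g : X → Fin n → ℂ} (hf : Continuous f) (hg : Continuous g) :
    Continuous fun x => lascouxDet t (f x) (g x) := by
  have he (k : ℤ) : Continuous fun x => elemSymm (g x) k := by
    unfold elemSymm
    split_ifs
    · exact continuous_const
    · exact (MvPolynomial.continuous_eval _).comp hg
  have hh (k : ℤ) : Continuous fun x => complSymm (f x) k := by
    unfold complSymm
    split_ifs
    · exact continuous_const
    · exact (MvPolynomial.continuous_eval _).comp hf
  refine Continuous.matrix_det (Continuous.matrix_mul ?_ ?_)
  · exact continuous_matrix fun i j => hh _
  · exact continuous_matrix fun i j => continuous_const.mul (he _)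

theorem finite_setOf_add_mul_eq {ι : Type*} [Finite ι] (a b c d : ι → ℂ) (h : ∀ i, b i ≠ d i) :
    {s : ℂ | ∃ i, a i + s * b i = c i + s * d i}.Finite := by
  rw [Set.ofPred_exists]
  refine Set.finite_iUnion fun i => Set.Subsingleton.finite fun s hs r hr => ?_
  simp only [Set.mem_ofPred_eq] at hs hr
  apply mul_right_cancel₀ (sub_ne_zero.mpr (h i))
  linear_combination hs - hr

theorem dense_setOf_injective_add_mul {ι : Type*} [Finite ι] (a b : ι → ℂ)
    (hb : Function.Injective b) :
    Dense {s : ℂ | Function.Injective fun i => a i + s * b i} := by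
  have h := finite_setOf_add_mul_eq (ι := {p : ι × ι // p.1 ≠ p.2}) (fun p => a p.1.1)
    (fun p => b p.1.1) (fun p => a p.1.2) (fun p => b p.1.2) fun p => hb.ne p.2
  refine (h.countable.dense_compl ℂ).mono fun s hs i j hij => ?_
  by_contra hne
  exact hs ⟨⟨(i, j), hne⟩, hij⟩

theorem icePolynomial_eq {q : ℂ} (hq : q ^ 2 ≠ 1) {n : ℕ} (u v : Fin n → ℂ) :
    icePolynomial q u v (fun _ => true) (fun _ => false) =
      (1 - q ^ 2) ^ n * (∏ j, v j) * lascouxDet (q ^ 2) v u := by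
  -- The parameters move along a complex line with distinct nonzero slopes. The fixed point `none ↦
  -- 0` makes injectivity encode nonvanishing too, and it fails for only finitely many `s`.
  let a : Option (Fin n ⊕ Fin n) → ℂ := fun o => o.elim 0 (Sum.elim u v)
  let b : Option (Fin n ⊕ Fin n) → ℂ := fun o =>
    o.elim 0 fun x => ((Fintype.equivFin _ x : ℕ) : ℂ) + 1
  have hb : Function.Injective b := by
    rintro (_ | x) (_ | y) h <;> simp only [b, Option.elim] at h
    · rfl
    · exact absurd h.symm (Nat.cast_add_one_ne_zero _)
    · exact absurd h (Nat.cast_add_one_ne_zero _)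
    · simpa [Fin.val_inj] using h
  let f : ℂ → Fin n → ℂ := fun s i => u i + s * b (some (.inl i))
  let g : ℂ → Fin n → ℂ := fun s j => v j + s * b (some (.inr j))
  have hf : Continuous f := by fun_prop
  have hg : Continuous g := by fun_prop
  have h := Continuous.ext_on (dense_setOf_injective_add_mul a b hb)
    (continuous_icePolynomial q hf hg (fun _ => true) (fun _ => false))
    ((continuous_const.mul (continuous_finsetProd _ fun j _ => (continuous_apply j).comp hg)).mul
      (continuous_lascouxDet (q ^ 2) hg hf)) fun s hs => icePolynomial_eq_of_injective hq _ _
        (fun i j hij => ?_) (fun i j hij => ?_) (fun i hi => ?_) (fun j hj => ?_) fun i j hij => ?_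
  · simpa [f, g] using congrFun h 0
  · simpa using @hs (some (.inl i)) (some (.inl j)) hij
  · simpa using @hs (some (.inr i)) (some (.inr j)) hij
  · simpa using @hs (some (.inl i)) none (by simpa [a, b, f] using hi)
  · simpa using @hs (some (.inr j)) none (by simpa [a, b, g] using hj)
  · simpa using @hs (some (.inl i)) (some (.inr j)) hij

end

end SquareIce

theorem theorem3p2 (n : ℕ) (hn : 0 < n) (q : ℂ) (hq0 : q ≠ 0) (hq : q ^ 2 ≠ 1)
    (x y u v : Fin n → ℂ)
    (hu : ∀ i, u i = q ^ (2 * x i)) (hv : ∀ i, v i = q ^ (2 * y i)) :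
    SquareIce.partitionFunction q x y =
      (-1) ^ (n ^ 2)
        / ((q ^ 2 - 1) ^ (n ^ 2 - n) * ∏ i, (q ^ ((n : ℂ) * (x i + y i)) * (v i)⁻¹))
        * SquareIce.lascouxDet (q ^ 2) v u := by
  have ht : q ^ 2 - 1 ≠ 0 := sub_ne_zero.mpr hq
  have hqz (z : ℂ) : q ^ z ≠ 0 := by simp [Complex.cpow_eq_zero_iff, hq0]
  have hx : ∏ i, q ^ x i ≠ 0 := Finset.prod_ne_zero_iff.mpr fun i _ => hqz _
  have hy : ∏ i, q ^ y i ≠ 0 := Finset.prod_ne_zero_iff.mpr fun i _ => hqz _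
  have hv0 : ∏ i, v i ≠ 0 := Finset.prod_ne_zero_iff.mpr fun i _ => by simpa [hv] using hqz _
  have hu' : (fun i => q ^ (2 * x i)) = u := funext fun i => (hu i).symm
  have hv' : (fun i => q ^ (2 * y i)) = v := funext fun i => (hv i).symm
  have h1 : ∏ i, ∏ j, (q ^ x i * q ^ y j * (q ^ 2 - 1))⁻¹ =
      ((∏ i, q ^ x i) ^ n * (∏ i, q ^ y i) ^ n * (q ^ 2 - 1) ^ (n ^ 2))⁻¹ := by
    simp [Finset.prod_mul_distrib, Finset.prod_pow, Finset.prod_const, sq n, pow_mul]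
  have h2 : ∏ i, (q ^ ((n : ℂ) * (x i + y i)) * (v i)⁻¹) =
      (∏ i, q ^ x i) ^ n * (∏ i, q ^ y i) ^ n * (∏ i, v i)⁻¹ := by
    simp [Finset.prod_mul_distrib, Complex.cpow_nat_mul, Complex.cpow_add _ _ hq0, mul_pow,
      Finset.prod_pow]
  have h3 : (q ^ 2 - 1) ^ (n ^ 2) = (q ^ 2 - 1) ^ (n ^ 2 - n) * (q ^ 2 - 1) ^ n := by
    rw [← pow_add, Nat.sub_add_cancel (Nat.le_self_pow two_ne_zero n)]
  -- The sign is `(-1) ^ n`, and `n ^ 2` has the parity of `n`.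
  have h4 : (1 - q ^ 2) ^ n = (-1) ^ (n ^ 2) * (q ^ 2 - 1) ^ n := by
    have : (-1 : ℂ) ^ (n ^ 2) = (-1) ^ n := by
      rcases Nat.even_or_odd n with h | h
      · rw [h.neg_one_pow, (h.pow_of_ne_zero two_ne_zero).neg_one_pow]
      · rw [h.neg_one_pow, h.pow.neg_one_pow]
    rw [this, ← mul_pow]
    ring
  rw [SquareIce.partitionFunction_eq hq0 hq, hu', hv', SquareIce.icePolynomial_eq hq, h1, h2, h3,
    h4]
  field_simp
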